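/- **Setting.** Let $E$ be a Lusin space (a space homeomorphic to a Borel subset of a compact metric space) with its Borel $\sigma$-algebra $\mathscr E$. A conservative Borel right process on $E$ is a process $X=(\Omega,\mathscr F,(X_t)_{t\ge 0},(\mathbb P_x)_{x\in E})$ with values in $E$, with right-continuous paths, shift operators $\theta_t$ on $\Omega$ ($X_s\circ\theta_t=X_{s+t}$), $\mathbb P_x(X_0=x)=1$, a Borel measurable transition function $P_t(x,B)=\mathbb P_x(X_t\in B)$, and the strong Markov property. A family $(Q_t(x,\cdot))_{t\ge0,\,x\in E}$ of measures on $E$ is called recurrent if for every universally measurable $B\subseteq E$ the function $x\mapsto\int_0^\infty Q_t(x,B)\,dt$ is either identically $0$ or identically $\infty$ on $E$; $X$ is recurrent if $(P_t)$ is. A pricing kernel $S=(S_t)_{t\ge 0}$ is transition independent with $(\pi,\lambda)$, where $\pi:E\to(0,\infty)$ is a Borel function and $\lambda\in\mathbb R$, if almost surely under every $\mathbb P_x$ $$S_t=e^{-\lambda t}\,\frac{\pi(X_0)}{\pi(X_t)}\qquad\text{for all } t\ge 0 .$$ The Arrow–Debreu state prices generated by $S$ are the measures $\mathscr P_t(x,B)=\mathbb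 E_x[S_t\mathbf 1_B(X_t)]$. A pair $(\pi,\lambda)$, with $\pi:E\to(0,\infty)$ Borel and $\lambda\in\mathbb R$, is a positive eigenpair of the state prices if $\int_E\pi(y)\,\mathscr P_t(x,dy)=e^{-\lambda t}\pi(x)$ for all $t\ge0$ and $x\in E$. Its eigen-measure is a family $(\mathbb Q^{\pi}_x)_{x\in E}$ with $d\mathbb Q^\pi_x=e^{\lambda t}\frac{\pi(X_t)}{\pi(X_0)}S_t\,d\mathbb P_x$ on $\sigma(X_s,s\le t)$ for all $t\ge 0$; under it $X$ has the transition function $$Q^{\pi}_t(x,dy)=e^{\lambda t}\,\frac{\pi(y)}{\pi(x)}\,\mathscr P_t(x,dy).$$ The eigenpair is recurrent if $(Q^\pi_t)$ is recurrent. **Theorem (Ross' Recovery Theorem for recurrent Borel right processes).** Let $X$ be a recurrent conservative Borel right process on a non-empty Lusin space $E$, and let the state prices $\mathscr P_t(x,dy)$ be generated by a pricing kernel $S$ that is transition independent with $(\pi,\lambda)$. Then: 1. $(\pi,\lambda)$ is a recurrent eigenpair of the state prices, the physical measure $(\mathbb P_x)$ is its eigen-measure, and $P_t(x,dy)=e^{\lambda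 t}\frac{\pi(y)}{\pi(x)}\mathscr P_t(x,dy)$ for all $t\ge0$, $x\in E$. 2. The recurrent eigenpair and the recurrent eigen-measure are unique: if $(\pi',\lambda')$ is any recurrent eigenpair of the state prices, then $\lambda'=\lambda$, $\pi'=c\,\pi$ for some constant $c>0$, $Q^{\pi'}_t=P_t$ for all $t\ge0$, and every eigen-measure of $(\pi',\lambda')$ coincides with $(\mathbb P_x)$ on $\sigma(X_s,s\ge0)$. 3. The recovery problem has a unique solution: if $X'$ is any recurrent conservative Borel right process on $E$ (possibly on another sample space) with a pricing kernel $S'$ that is transition independent with some $(\pi',\lambda')$ and that generates the same state prices $\mathscr P_t(x,dy)$, then $X'$ has the same transition function as $X$ and, for every $x\in E$, the same law of paths started from $x$ (on the product $\sigma$-algebra of $E^{[0,\infty)}$), $\lambda'=\lambda$, $\pi'=c\,\pi$ for some constant $c>0$, and almost surely under every $\mathbb P'_x$, $S'_t=e^{-\lambda t}\pi(X'_0)/\pi(X'_t)$ for all $t\ge 0$. -/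

import Mathlib

open MeasureTheory Set
open scoped NNReal ENNReal

noncomputable section

/-- `E` is a (metrizable) Lusin topological space: it is homeomorphic to a Borel subset of some
compact metric space. -/
class LusinSpace (E : Type*) [TopologicalSpace E] : Prop where
  exists_embedding : ∃ (K : Type) (_ : MetricSpace K) (_ : CompactSpace K) (f : E → K),
    Topology.IsEmbedding f ∧ MeasurableSet[borel K] (range f)

/-- The minimum admissible filtration `ℱ⁰_t = σ(X_s, s ≤ t)` of a process `X`. -/
def minFiltration {E Ω : Type*} [MeasurableSpace E] [mΩ : MeasurableSpace Ω]
    (X : ℝ≥0 → Ω → E) (hX : ∀ t, Measurable (X t)) : Filtration ℝ≥0 mΩ where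
  seq t := ⨆ s ≤ t, MeasurableSpace.comap (X s) inferInstance
  mono' _ _ hst := biSup_mono fun _ hr => hr.trans hst
  le' _ := iSup₂_le fun s _ => (hX s).comap_le

/-- A conservative Borel right process on the state space `E` with sample space `Ω`
(the state space is meant to be a Lusin space with its Borel σ-algebra).
Since every `X t` takes its values in `E`, there is no killing and no cemetery state. -/
structure BorelRightProcess (E Ω : Type*) [TopologicalSpace E] [MeasurableSpace E]
    [mΩ : MeasurableSpace Ω] where
  /-- the process -/
  X : ℝ≥0 → Ω → E
  /-- `P x` governs the process started from `x` -/
  P : E → Measure Ω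
  isProb : ∀ x, IsProbabilityMeasure (P x)
  measurable_X : ∀ t, Measurable (X t)
  /-- Borel measurability of the transition function -/
  measurable_transition : ∀ (t : ℝ≥0) (B : Set E), MeasurableSet B →
    Measurable fun x => P x (X t ⁻¹' B)
  /-- normality -/
  normal : ∀ x, ∀ᵐ ω ∂P x, X 0 ω = x
  /-- existence of shift operators -/
  exists_shift : ∀ t, ∃ θ : Ω → Ω, ∀ s ω, X s (θ ω) = X (s + t) ω
  rightContinuous : ∀ ω t, ContinuousWithinAt (fun s => X s ω) (Ici t) t
  /-- The strong Markov property `P_x(X_{σ+s} ∈ B | ℱ⁰_{σ+}) = P_{X_σ}(X_s ∈ B)` a.s. on `{σ < ∞}`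
  for the stopping times `σ` of the right-continuous filtration `ℱ⁰_{t+}`, the conditional
  probability being written through integrals over the events of the past of `σ`.
  Integration in `x` gives it for every initial distribution. -/
  strongMarkov : ∀ (σ : Ω → WithTop ℝ≥0)
    (hσ : IsStoppingTime (minFiltration X measurable_X).rightCont σ)
    (A : Set Ω), MeasurableSet[hσ.measurableSpace] A →
    ∀ (x : E) (s : ℝ≥0) (B : Set E), MeasurableSet B →
      P x {ω | ω ∈ A ∧ σ ω ≠ ⊤ ∧ X ((σ ω).untopD 0 + s) ω ∈ B} =
        ∫⁻ ω in {ω | ω ∈ A ∧ σ ω ≠ ⊤}, P (X ((σ ω).untopD 0) ω) (X s ⁻¹' B) ∂P x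

/-- `B` is universally measurable: measurable with respect to the completion of every finite
Borel measure. -/
def UniversallyMeasurable {E : Type*} [MeasurableSpace E] (B : Set E) : Prop :=
  ∀ μ : Measure E, IsFiniteMeasure μ → NullMeasurableSet B μ

/-- The potential (Green's) measure `R(x, B) = ∫₀^∞ Q_t(x, B) dt` of a family of transition
measures. -/
def potential {E : Type*} [MeasurableSpace E] (Q : ℝ≥0 → E → Measure E) (x : E) (B : Set E) :
    ℝ≥0∞ :=
  ∫⁻ t in Ici (0 : ℝ), Q t.toNNReal x B

/-- Recurrence: for every universally measurable `B`, either `R(·, B)` vanishes identically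
or it is identically infinite. -/
def RecurrentTransition {E : Type*} [MeasurableSpace E] (Q : ℝ≥0 → E → Measure E) : Prop :=
  ∀ B : Set E, UniversallyMeasurable B →
    (∀ x, potential Q x B = 0) ∨ (∀ x, potential Q x B = ∞)

/-- `π` is an eigenfunction of all the pricing operators `f ↦ ∫ f(y) AD_t(x, dy)`, strictly
positive, finite and Borel, with eigenvalues `e^{-λt}`. -/
structure IsPositiveEigenpair {E : Type*} [MeasurableSpace E] (AD : ℝ≥0 → E → Measure E)
    (π : E → ℝ) (lam : ℝ) : Prop where
  measurable : Measurable π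
  pos : ∀ x, 0 < π x
  eigen : ∀ t x, ∫⁻ y, ENNReal.ofReal (π y) ∂AD t x =
    ENNReal.ofReal (Real.exp (-(lam * t)) * π x)

/-- The transition measures `Q^π_t(x, dy) = e^{λt} (π(y) / π(x)) AD_t(x, dy)` under the
eigen-measure associated with `(π, λ)`. -/
def eigenTransition {E : Type*} [MeasurableSpace E] (AD : ℝ≥0 → E → Measure E)
    (π : E → ℝ) (lam : ℝ) : ℝ≥0 → E → Measure E :=
  fun t x => (AD t x).withDensity fun y => ENNReal.ofReal (Real.exp (lam * t) * (π y / π x))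

/-- `(π, λ)` is a positive eigenpair such that the process is recurrent under the associated
eigen-measure. -/
def IsRecurrentEigenpair {E : Type*} [MeasurableSpace E] (AD : ℝ≥0 → E → Measure E)
    (π : E → ℝ) (lam : ℝ) : Prop :=
  IsPositiveEigenpair AD π lam ∧ RecurrentTransition (eigenTransition AD π lam)

namespace BorelRightProcess

variable {E Ω : Type*} [TopologicalSpace E] [MeasurableSpace E] [mΩ : MeasurableSpace Ω]

/-- The transition function `P_t(x, ·)`, the law of `X_t` under `P_x`. -/
def transition (Z : BorelRightProcess E Ω) (t : ℝ≥0) (x : E) : Measure E :=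
  (Z.P x).map (Z.X t)

/-- The law of the whole path `(X_t)_{t ≥ 0}` under `P_x`, on the product σ-algebra. -/
def pathLaw (Z : BorelRightProcess E Ω) (x : E) : Measure (ℝ≥0 → E) :=
  (Z.P x).map fun ω t => Z.X t ω

/-- Recurrence of the process under its own measures `(P_x)`. -/
def IsRecurrent (Z : BorelRightProcess E Ω) : Prop :=
  RecurrentTransition Z.transition

/-- The pricing kernel `S` is transition independent with the strictly positive, finite Borel
function `π` and the real constant `λ`: almost surely, `S_t = e^{-λt} π(X_0) / π(X_t)` for
all `t`. -/
structure TransitionIndependent (Z : BorelRightProcess E Ω) (S : ℝ≥0 → Ω → ℝ)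
    (π : E → ℝ) (lam : ℝ) : Prop where
  measurable : Measurable π
  pos : ∀ x, 0 < π x
  kernel_eq : ∀ x, ∀ᵐ ω ∂Z.P x, ∀ t : ℝ≥0,
    S t ω = Real.exp (-(lam * t)) * (π (Z.X 0 ω) / π (Z.X t ω))

/-- The Arrow–Debreu state-price measures `AD_t(x, B) = E_x[S_t 1_B(X_t)]` generated by the
pricing kernel `S`. -/
def statePrice (Z : BorelRightProcess E Ω) (S : ℝ≥0 → Ω → ℝ) (t : ℝ≥0) (x : E) : Measure E :=
  ((Z.P x).withDensity fun ω => ENNReal.ofReal (S t ω)).map (Z.X t)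

/-- `(Q_x)` is the eigen-measure of the eigenpair `(π, λ)`: on every `ℱ⁰_t` the measure `Q_x`
has the density `M_t = e^{λt} (π(X_t) / π(X_0)) S_t` with respect to `P_x`. -/
def IsEigenMeasure (Z : BorelRightProcess E Ω) (S : ℝ≥0 → Ω → ℝ) (π : E → ℝ) (lam : ℝ)
    (Q : E → Measure Ω) : Prop :=
  ∀ (t : ℝ≥0) (x : E) (A : Set Ω), MeasurableSet[minFiltration Z.X Z.measurable_X t] A →
    Q x A = ∫⁻ ω in A,
      ENNReal.ofReal (Real.exp (lam * t) * (π (Z.X t ω) / π (Z.X 0 ω)) * S t ω) ∂Z.P x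

end BorelRightProcess

end

/-! Transition independence says that the state prices are the `h`-transform of `P_t` with density
`e^{-λt} π(x)/π(y)`. So for another eigenpair `(π', λ')` the ratio `h = π'/π` satisfies `P_t h =
e^{-ct} h` with `c = λ' - λ`, and `Q^{π'}` is the `h`-transform of `P`
(`eigenTransition_statePrice`). Everything reduces to
`eq_zero_and_exists_eq_of_recurrent_transform`: if both `P` and its transform are recurrent, then `c
= 0` and `h` is constant.

If `c > 0`, Markov's inequality makes `P_t(x, {h ≥ 1/n})` decay exponentially; if `c < 0`, the
transform's mass on `{h ≤ n}` does. Either way every set of a countable cover of `E` has finite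
potential, which recurrence forbids (`not_exp_decay`).

If `c = 0`, then `h` is harmonic and `w = 1/(1+h)` is bounded and subharmonic. The total gain of `w`
along the process is bounded, so sets of definite gain have finite, hence zero, potential. At some
`y` there is thus no gain at all; the equality case of Jensen gives `h = h(y)` almost surely under
each `P_t(y, ·)`, and recurrence carries this to every starting point (`exists_eq_of_harmonic`).

Equal transition functions give equal path laws through the finite-dimensional distributions. -/

theorem UniversallyMeasurable.of_measurableSet {E : Type*} [MeasurableSpace E] {B : Set E}
    (hB : MeasurableSet B) : UniversallyMeasurable B :=
  fun _ _ => hB.nullMeasurableSet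

/-- A family of probability measures on `E` which is measurable in the starting point and in time
and satisfies the Chapman-Kolmogorov equations. -/
structure IsMarkovTransition {E : Type*} [MeasurableSpace E] (P : ℝ≥0 → E → Measure E) :
    Prop where
  isProb : ∀ t x, IsProbabilityMeasure (P t x)
  measurable_space : ∀ t, Measurable (P t)
  measurable_time : ∀ x, Measurable fun t => P t x
  chapmanKolmogorov : ∀ (s t : ℝ≥0) (x : E) (f : E → ℝ≥0∞), Measurable f →
    ∫⁻ y, f y ∂P (s + t) x = ∫⁻ y, ∫⁻ z, f z ∂P t y ∂P s x

/-! ### Potentials and recurrence -/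

section Potential

variable {E : Type*} [MeasurableSpace E] {P : ℝ≥0 → E → Measure E}

theorem potential_eq_bind {x : E} (hP : Measurable fun t => P t x) {B : Set E}
    (hB : MeasurableSet B) :
    potential P x B =
      ((volume.restrict (Ici (0 : ℝ))).bind fun t => P t.toNNReal x) B := by
  exact (Measure.bind_apply hB (hP.comp measurable_real_toNNReal).aemeasurable).symm

theorem potential_univ (hprob : ∀ t x, IsProbabilityMeasure (P t x)) (x : E) :
    potential P x univ = ∞ := by
  simp [potential]

theorem potential_iUnion_eq_zero {x : E} (hP : Measurable fun t => P t x) {ι : Type*} [Countable ι]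
    {B : ι → Set E} (hB : ∀ i, MeasurableSet (B i)) (h : ∀ i, potential P x (B i) = 0) :
    potential P x (⋃ i, B i) = 0 := by
  rw [potential_eq_bind hP (MeasurableSet.iUnion hB), measure_iUnion_null_iff]
  intro i
  rw [← potential_eq_bind hP (hB i), h i]

/-- Otherwise every `B i` has zero potential by the dichotomy, hence so has their union, whereas the
potential of the whole space is infinite. -/
theorem exists_forall_potential_eq_top [Nonempty E] (hrec : RecurrentTransition P)
    (hprob : ∀ t x, IsProbabilityMeasure (P t x)) (hP : ∀ x, Measurable fun t => P t x)
    {ι : Type*} [Countable ι] {B : ι → Set E} (hB : ∀ i, MeasurableSet (B i))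
    (hU : ⋃ i, B i = univ) : ∃ i, ∀ x, potential P x (B i) = ∞ := by
  by_contra! hne
  have h0 : ∀ i x, potential P x (B i) = 0 := fun i =>
    (hrec (B i) (.of_measurableSet (hB i))).resolve_right fun h =>
      let ⟨x, hx⟩ := hne i; hx (h x)
  obtain ⟨x⟩ := ‹Nonempty E›
  have := potential_iUnion_eq_zero (hP x) hB fun i => h0 i x
  rw [hU, potential_univ hprob] at this
  exact ENNReal.top_ne_zero this

theorem lintegral_Ici_exp_neg_lt_top {a : ℝ} (ha : 0 < a) (C : ℝ) :
    ∫⁻ t in Ici (0 : ℝ), ENNReal.ofReal (C * Real.exp (-(a * t))) < ∞ := by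
  have h : IntegrableOn (fun t : ℝ => C * Real.exp (-(a * t))) (Ici 0) := by
    rw [integrableOn_Ici_iff_integrableOn_Ioi]
    have := (exp_neg_integrableOn_Ioi 0 ha).const_mul C
    simp only [neg_mul] at this
    exact this
  exact h.lintegral_lt_top

/-- The mass which a recurrent family puts on sublevel sets cannot decay exponentially. -/
theorem RecurrentTransition.not_exp_decay [Nonempty E] (hrec : RecurrentTransition P)
    (hprob : ∀ t x, IsProbabilityMeasure (P t x)) (hP : ∀ x, Measurable fun t => P t x)
    {k : E → ℝ} (hk : Measurable k) {a : ℝ} (ha : 0 < a)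
    (h : ∀ (n : ℕ) (x : E), ∃ C : ℝ, ∀ t : ℝ≥0,
      P t x {y | k y ≤ n} ≤ ENNReal.ofReal (C * Real.exp (-(a * t)))) : False := by
  obtain ⟨n, hn⟩ := exists_forall_potential_eq_top (B := fun n : ℕ => {y | k y ≤ n}) hrec hprob hP
    (fun n => measurableSet_le hk measurable_const)
    (eq_univ_of_forall fun y => mem_iUnion.2 (exists_nat_ge (k y)))
  obtain ⟨x⟩ := ‹Nonempty E›
  obtain ⟨C, hC⟩ := h n x
  refine (lintegral_Ici_exp_neg_lt_top ha C).ne (top_le_iff.1 ?_)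
  rw [← hn x]
  refine setLIntegral_mono' measurableSet_Ici fun t ht => (hC t.toNNReal).trans_eq ?_
  rw [Real.coe_toNNReal t ht]

end Potential

/-! ### Two inputs: a telescoping bound and Jensen's identity -/

/-- A continuous telescoping sum: over `[0, n]` the integrals of `F(t + c)` and `F(t)` differ by at
most the integral of `F ≤ 1` over a window of length `c`, uniformly in `n`. -/
theorem lintegral_Ici_le_of_add_le_shift {F b : ℝ → ℝ≥0∞} (hF : Measurable F) (hF1 : ∀ t, F t ≤ 1)
    {c : ℝ} (hc : 0 ≤ c) (h : ∀ t, 0 ≤ t → b t + F t ≤ F (t + c)) :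
    ∫⁻ t in Ici (0 : ℝ), b t ≤ ENNReal.ofReal c := by
  have key : ∀ n : ℕ, ∫⁻ t in Icc (0 : ℝ) n, b t ≤ ENNReal.ofReal c := by
    intro n
    have hfin : ∫⁻ t in Icc (0 : ℝ) n, F t ≠ ∞ := by
      refine ((setLIntegral_mono measurable_const fun t _ => hF1 t).trans_lt ?_).ne
      simp
    refine (ENNReal.add_le_add_iff_right hfin).1 ?_
    calc (∫⁻ t in Icc (0 : ℝ) n, b t) + ∫⁻ t in Icc (0 : ℝ) n, F t
        = ∫⁻ t in Icc (0 : ℝ) n, (b t + F t) := (lintegral_add_right _ hF).symm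
      _ ≤ ∫⁻ t in Icc (0 : ℝ) n, F (t + c) :=
          setLIntegral_mono' measurableSet_Icc fun t ht => h t ht.1
      _ = ∫⁻ t in (fun t => t + c) ⁻¹' Icc c (n + c), F (t + c) := by
          congr 2
          ext t
          simp
      _ = ∫⁻ t in Icc c (n + c), F t :=
          (measurePreserving_add_right volume c).setLIntegral_comp_preimage measurableSet_Icc hF
      _ ≤ ∫⁻ t in Icc (n : ℝ) (n + c) ∪ Icc (0 : ℝ) n, F t := by
          refine lintegral_mono_set fun t ht => ?_
          rcases le_total t n with h' | h'
          · exact Or.inr ⟨hc.trans ht.1, h'⟩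
          · exact Or.inl ⟨h', ht.2⟩
      _ ≤ (∫⁻ t in Icc (n : ℝ) (n + c), F t) + ∫⁻ t in Icc (0 : ℝ) n, F t :=
          lintegral_union_le _ _ _
      _ ≤ ENNReal.ofReal c + ∫⁻ t in Icc (0 : ℝ) n, F t := by
          gcongr
          refine (setLIntegral_mono measurable_const fun t _ => hF1 t).trans_eq ?_
          simp
  have hU : Ici (0 : ℝ) = ⋃ n : ℕ, Icc (0 : ℝ) n := by
    ext t
    simp only [mem_Ici, mem_iUnion, mem_Icc, exists_and_left]
    exact ⟨fun ht => ⟨ht, exists_nat_ge t⟩, fun ht => ht.1⟩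
  rw [hU, setLIntegral_iUnion_of_directed]
  · exact iSup_le key
  · refine Monotone.directed_le fun m n hmn => Icc_subset_Icc_right ?_
    exact_mod_cast hmn

/-- Jensen's identity for the strictly convex function `s ↦ 1 / (1 + s)`. -/
theorem lintegral_inv_one_add {E : Type*} [MeasurableSpace E] {μ : Measure E}
    [IsProbabilityMeasure μ] {h : E → ℝ} (hm : Measurable h) (hpos : ∀ y, 0 < h y) {a : ℝ}
    (ha : 0 < a) (hint : ∫⁻ y, ENNReal.ofReal (h y) ∂μ = ENNReal.ofReal a) :
    ∫⁻ y, ENNReal.ofReal (1 / (1 + h y)) ∂μ = ENNReal.ofReal (1 / (1 + a)) +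
      ∫⁻ y, ENNReal.ofReal ((h y - a) ^ 2 / ((1 + h y) * (1 + a) ^ 2)) ∂μ := by
  -- `-1 / (1 + a)^2` is the slope of the tangent at `a`. Adding the linear term to both sides
  -- avoids subtraction in `ℝ≥0∞`.
  have hb : 0 ≤ 1 / (1 + a) ^ 2 := by positivity
  have hmul : ∫⁻ y, ENNReal.ofReal (1 / (1 + a) ^ 2 * h y) ∂μ =
      ENNReal.ofReal (1 / (1 + a) ^ 2 * a) := by
    simp_rw [ENNReal.ofReal_mul hb]
    rw [lintegral_const_mul _ (by fun_prop), hint]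
  have hsum : ∫⁻ y, ENNReal.ofReal (1 / (1 + h y)) ∂μ + ENNReal.ofReal (1 / (1 + a) ^ 2 * a) =
      (ENNReal.ofReal (1 / (1 + a)) +
        ∫⁻ y, ENNReal.ofReal ((h y - a) ^ 2 / ((1 + h y) * (1 + a) ^ 2)) ∂μ) +
        ENNReal.ofReal (1 / (1 + a) ^ 2 * a) := by
    rw [← hmul, ← lintegral_add_right _ (by fun_prop), hmul, add_right_comm,
      ← ENNReal.ofReal_add (by positivity) (by positivity)]
    have hc : ∀ r : ℝ, ENNReal.ofReal r = ∫⁻ _, ENNReal.ofReal r ∂μ := by simp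
    rw [hc (1 / (1 + a) + _), ← lintegral_add_left measurable_const]
    refine lintegral_congr fun y => ?_
    have hy := hpos y
    rw [← ENNReal.ofReal_add (by positivity) (by positivity),
      ← ENNReal.ofReal_add (by positivity) (by positivity)]
    congr 1
    field_simp
    ring
  exact (ENNReal.add_left_inj ENNReal.ofReal_ne_top).1 hsum

/-! ### Harmonic functions and `h`-transforms of recurrent transition functions -/

section Harmonic

variable {E : Type*} [MeasurableSpace E] {P : ℝ≥0 → E → Measure E}

/-- The mass of the set where the mean of `w` gains at least `ε` in time `s`. -/
theorem IsMarkovTransition.potential_gain_lt_top (hP : IsMarkovTransition P) {w : E → ℝ≥0∞}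
    (hw : Measurable w) (hw1 : ∀ y, w y ≤ 1) (hsub : ∀ t y, w y ≤ ∫⁻ z, w z ∂P t y)
    (s : ℝ≥0) {ε : ℝ≥0∞} (hε : ε ≠ 0) (hε' : ε ≠ ∞) (x : E) :
    potential P x {y | w y + ε ≤ ∫⁻ z, w z ∂P s y} < ∞ := by
  have := hP.isProb
  set B := {y | w y + ε ≤ ∫⁻ z, w z ∂P s y} with hBdef
  have hWm : Measurable fun y => ∫⁻ z, w z ∂P s y :=
    (Measure.measurable_lintegral hw).comp (hP.measurable_space s)
  have hB : MeasurableSet B := measurableSet_le (hw.add_const ε) hWm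
  set F : ℝ → ℝ≥0∞ := fun t => ∫⁻ z, w z ∂P t.toNNReal x with hF
  have hFm : Measurable F := (Measure.measurable_lintegral hw).comp
    ((hP.measurable_time x).comp measurable_real_toNNReal)
  have hF1 : ∀ t, F t ≤ 1 := fun t => (lintegral_mono hw1).trans (by simp)
  -- By Chapman-Kolmogorov `F (t + s)` averages `P_s w` over the position at time `t`; it exceeds
  -- `w` by at least `ε` on `B` and is never below `w` elsewhere.
  have hstep : ∀ t : ℝ, 0 ≤ t → ε * P t.toNNReal x B + F t ≤ F (t + s) := by
    intro t ht
    have hts : (t + s).toNNReal = t.toNNReal + s := by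
      rw [Real.toNNReal_add ht s.coe_nonneg, Real.toNNReal_coe]
    simp only [hF]
    rw [hts, hP.chapmanKolmogorov _ _ _ _ hw, ← lintegral_indicator_const hB,
      ← lintegral_add_right _ hw]
    refine lintegral_mono fun y => ?_
    by_cases hy : y ∈ B
    · rw [indicator_of_mem hy, add_comm]
      exact hy
    · rw [indicator_of_notMem hy, zero_add]
      exact hsub s y
  have hle := lintegral_Ici_le_of_add_le_shift hFm hF1 s.2 hstep
  rw [lintegral_const_mul' _ _ hε'] at hle
  by_contra htop
  rw [not_lt, top_le_iff] at htop
  rw [show ∫⁻ t in Ici (0 : ℝ), P t.toNNReal x B = ∞ from htop, ENNReal.mul_top hε] at hle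
  exact ENNReal.ofReal_ne_top (top_le_iff.1 hle)

/-- Positive harmonic functions of a recurrent Markov transition function are constant. -/
theorem IsMarkovTransition.exists_eq_of_harmonic [Nonempty E] (hP : IsMarkovTransition P)
    (hrec : RecurrentTransition P) {h : E → ℝ} (hm : Measurable h) (hpos : ∀ y, 0 < h y)
    (hharm : ∀ t x, ∫⁻ y, ENNReal.ofReal (h y) ∂P t x = ENNReal.ofReal (h x)) :
    ∃ k, 0 < k ∧ ∀ x, h x = k := by
  have := hP.isProb
  set w : E → ℝ≥0∞ := fun y => ENNReal.ofReal (1 / (1 + h y)) with hwdef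
  have hw : Measurable w := by fun_prop
  have hw1 : ∀ y, w y ≤ 1 := fun y => by
    have := hpos y
    rw [hwdef, ENNReal.ofReal_le_one, div_le_one (by positivity)]
    linarith
  have hident := fun t y => lintegral_inv_one_add (μ := P t y) hm hpos (hpos y) (hharm t y)
  have hsub : ∀ t y, w y ≤ ∫⁻ z, w z ∂P t y := fun t y => by
    rw [hwdef, hident]
    exact le_self_add
  have hmono : ∀ (s t : ℝ≥0) y, ∫⁻ z, w z ∂P s y ≤ ∫⁻ z, w z ∂P (s + t) y := fun s t y => by
    rw [hP.chapmanKolmogorov s t y w hw]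
    exact lintegral_mono fun z => hsub t z
  have hWm : ∀ s, Measurable fun y => ∫⁻ z, w z ∂P s y := fun s =>
    (Measure.measurable_lintegral hw).comp (hP.measurable_space s)
  -- Integer times suffice, since `P_t w` increases with `t`. The `+ 1` keeps the threshold finite.
  set B : ℕ × ℕ → Set E := fun p => {y | w y + ((p.2 : ℝ≥0∞) + 1)⁻¹ ≤ ∫⁻ z, w z ∂P p.1 y}
    with hBdef
  have hB : ∀ p, MeasurableSet (B p) := fun p => measurableSet_le (hw.add_const _) (hWm _)
  have hB0 : ∀ p x, potential P x (B p) = 0 := fun p =>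
    (hrec (B p) (.of_measurableSet (hB p))).resolve_right fun htop => by
      obtain ⟨x⟩ := ‹Nonempty E›
      have hlt := hP.potential_gain_lt_top hw hw1 hsub p.1 (ε := ((p.2 : ℝ≥0∞) + 1)⁻¹)
        (by simp [ENNReal.add_eq_top]) (by simp) x
      exact hlt.ne (htop x)
  obtain ⟨y, hy⟩ : ∃ y, y ∉ ⋃ p, B p := by
    by_contra! hall
    obtain ⟨x⟩ := ‹Nonempty E›
    have h0 := potential_iUnion_eq_zero (hP.measurable_time x) hB fun p => hB0 p x
    rw [eq_univ_of_forall hall, potential_univ hP.isProb] at h0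
    exact ENNReal.top_ne_zero h0
  have hWn : ∀ n : ℕ, ∫⁻ z, w z ∂P n y ≤ w y := by
    intro n
    refine ENNReal.le_of_forall_pos_le_add fun ε hε _ => ?_
    obtain ⟨k, hk⟩ := ENNReal.exists_inv_nat_lt (a := ε) (by simpa using hε.ne')
    have hyk : y ∉ B (n, k) := fun h' => hy (mem_iUnion.2 ⟨_, h'⟩)
    refine (not_le.1 hyk).le.trans ?_
    gcongr
    exact (ENNReal.inv_le_inv.2 le_self_add).trans hk.le
  have hWt : ∀ t, ∫⁻ z, w z ∂P t y ≤ w y := by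
    intro t
    obtain ⟨n, hn⟩ := exists_nat_ge t
    refine le_trans ?_ (hWn n)
    have := hmono t (n - t) y
    rwa [add_tsub_cancel_of_le hn] at this
  -- With no gain at `y`, the quadratic remainder in Jensen's identity must vanish.
  have hae : ∀ t, ∀ᵐ z ∂P t y, h z = h y := by
    intro t
    have hle := hWt t
    rw [hwdef, hident] at hle
    have h0 : ∫⁻ z, ENNReal.ofReal ((h z - h y) ^ 2 / ((1 + h z) * (1 + h y) ^ 2)) ∂P t y = 0 := by
      refine nonpos_iff_eq_zero.1 ((ENNReal.add_le_add_iff_left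
        (ENNReal.ofReal_ne_top (r := 1 / (1 + h y)))).1 ?_)
      simpa using hle
    rw [lintegral_eq_zero_iff (by fun_prop)] at h0
    filter_upwards [h0] with z hz
    have hz' := hpos z
    have hy' := hpos y
    have hd : (h z - h y) ^ 2 / ((1 + h z) * (1 + h y) ^ 2) = 0 :=
      le_antisymm (ENNReal.ofReal_eq_zero.1 hz) (by positivity)
    rw [div_eq_zero_iff] at hd
    rcases hd with hd | hd
    · exact sub_eq_zero.1 (pow_eq_zero_iff two_ne_zero |>.1 hd)
    · exact absurd hd (by positivity)
  have hD : MeasurableSet {z | ¬ h z = h y} :=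
    (measurableSet_eq_fun hm measurable_const).compl
  -- The potential vanishes from `y`, which excludes the infinite alternative from every point.
  have hD0 : ∀ x, potential P x {z | ¬ h z = h y} = 0 := by
    refine (hrec _ (.of_measurableSet hD)).resolve_right fun htop => ?_
    have : potential P y {z | ¬ h z = h y} = 0 := by
      unfold potential
      simp_rw [ae_iff.1 (hae _)]
      simp
    exact ENNReal.top_ne_zero ((htop y).symm.trans this)
  refine ⟨h y, hpos y, fun x => ?_⟩
  have hx : ∀ᵐ t ∂volume.restrict (Ici (0 : ℝ)), P t.toNNReal x {z | ¬ h z = h y} = 0 := by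
    have := hD0 x
    unfold potential at this
    rwa [lintegral_eq_zero_iff] at this
    exact (Measure.measurable_coe hD).comp
      ((hP.measurable_time x).comp measurable_real_toNNReal)
  have : (ae (volume.restrict (Ici (0 : ℝ)))).NeBot := by
    rw [ae_neBot, Ne, Measure.restrict_eq_zero]
    simp
  obtain ⟨t, ht⟩ := hx.exists
  have hxt := hharm t.toNNReal x
  rw [lintegral_congr_ae (g := fun _ => ENNReal.ofReal (h y))
    ((ae_iff.2 ht).mono fun z hz => by rw [hz])] at hxt
  simp only [lintegral_const, measure_univ, mul_one] at hxt
  exact ((ENNReal.ofReal_eq_ofReal_iff (hpos y).le (hpos x).le).1 hxt).symm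

/-- If a recurrent Markov transition function and its `h`-transform by a positive eigenfunction
are both recurrent, then the eigenvalue is one and the eigenfunction is constant. -/
theorem IsMarkovTransition.eq_zero_and_exists_eq_of_recurrent_transform [Nonempty E]
    (hP : IsMarkovTransition P) (hrec : RecurrentTransition P) {h : E → ℝ} (hm : Measurable h)
    (hpos : ∀ y, 0 < h y) {c : ℝ}
    (heig : ∀ t x, ∫⁻ y, ENNReal.ofReal (h y) ∂P t x =
      ENNReal.ofReal (Real.exp (-(c * t)) * h x))
    (hrec' : RecurrentTransition fun t x =>
      (P t x).withDensity fun y => ENNReal.ofReal (Real.exp (c * t) * (h y / h x))) :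
    c = 0 ∧ ∃ k, 0 < k ∧ ∀ x, h x = k := by
  have := hP.isProb
  have hc : c = 0 := by
    rcases lt_trichotomy c 0 with hc | hc | hc
    · exfalso
      refine hrec'.not_exp_decay ?_ ?_ hm (neg_pos.2 hc) ?_
      · intro t x
        have hx := hpos x
        refine ⟨?_⟩
        rw [withDensity_apply _ .univ, Measure.restrict_univ]
        have : ∀ y, Real.exp (c * t) * (h y / h x) = Real.exp (c * t) / h x * h y :=
          fun y => by ring
        simp_rw [this, ENNReal.ofReal_mul (by positivity : 0 ≤ Real.exp (c * t) / h x)]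
        rw [lintegral_const_mul _ (by fun_prop), heig, ← ENNReal.ofReal_mul (by positivity),
          Real.exp_neg]
        rw [← ENNReal.ofReal_one]
        congr 1
        field_simp
      · intro x
        refine Measure.measurable_of_measurable_coe _ fun B hB => ?_
        have hx := hpos x
        have : ∀ (t : ℝ≥0) y, ENNReal.ofReal (Real.exp (c * t) * (h y / h x)) =
            ENNReal.ofReal (Real.exp (c * t)) * ENNReal.ofReal (h y / h x) :=
          fun t y => ENNReal.ofReal_mul (by positivity)
        simp_rw [withDensity_apply _ hB, this]
        have hmx : Measurable fun y => ENNReal.ofReal (h y / h x) := by fun_prop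
        simp_rw [lintegral_const_mul _ hmx, ← lintegral_indicator hB]
        exact Measurable.mul (by fun_prop)
          ((Measure.measurable_lintegral (hmx.indicator hB)).comp (hP.measurable_time x))
      · intro n x
        have hx := hpos x
        refine ⟨n / h x, fun t => ?_⟩
        rw [withDensity_apply _ (measurableSet_le hm measurable_const)]
        refine (setLIntegral_mono (g := fun _ => ENNReal.ofReal (n / h x * Real.exp (-(-c * t))))
          measurable_const fun y hy => ENNReal.ofReal_le_ofReal ?_).trans ?_
        · rw [neg_mul, neg_neg, mul_comm]
          have : h y ≤ n := hy
          gcongr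
        · rw [lintegral_const]
          exact mul_le_of_le_one_right' (by simpa using prob_le_one)
    · exact hc
    · exfalso
      -- The sublevel sets of `1/h` are the sets `{h ≥ 1/n}`, to which Markov's inequality for `h`
      -- applies.
      refine hrec.not_exp_decay hP.isProb hP.measurable_time hm.inv hc fun n x =>
        ⟨n * h x, fun t => ?_⟩
      have hB : MeasurableSet {y | (h⁻¹) y ≤ (n : ℝ)} := measurableSet_le hm.inv measurable_const
      calc P t x {y | (h⁻¹) y ≤ (n : ℝ)} = ∫⁻ y in {y | (h⁻¹) y ≤ (n : ℝ)}, 1 ∂P t x := by simp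
        _ ≤ ∫⁻ y in {y | (h⁻¹) y ≤ (n : ℝ)}, ENNReal.ofReal (n * h y) ∂P t x := by
            refine setLIntegral_mono (by fun_prop) fun y hy => ?_
            rw [ENNReal.one_le_ofReal]
            have hy' : (h y)⁻¹ ≤ n := hy
            exact (inv_le_iff_one_le_mul₀ (hpos y)).1 hy'
        _ ≤ ∫⁻ y, ENNReal.ofReal (n * h y) ∂P t x := setLIntegral_le_lintegral _ _
        _ = ENNReal.ofReal (n * h x * Real.exp (-(c * t))) := by
            simp_rw [ENNReal.ofReal_mul n.cast_nonneg]
            rw [lintegral_const_mul _ (by fun_prop), heig, ← ENNReal.ofReal_mul n.cast_nonneg]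
            congr 1
            ring
  refine ⟨hc, hP.exists_eq_of_harmonic hrec hm hpos fun t x => ?_⟩
  rw [heig, hc]
  simp

end Harmonic

/-! ### Joint measurability of right-continuous paths -/

theorem LusinSpace.metrizableSpace (E : Type*) [TopologicalSpace E] [LusinSpace E] :
    TopologicalSpace.MetrizableSpace E := by
  obtain ⟨K, _, _, f, hf, _⟩ := LusinSpace.exists_embedding (E := E)
  exact hf.metrizableSpace

/-- A right-continuous process is jointly measurable. -/
theorem measurable_uncurry_of_rightContinuous {E Ω : Type*} [TopologicalSpace E]
    [TopologicalSpace.PseudoMetrizableSpace E] [MeasurableSpace E] [BorelSpace E]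
    [MeasurableSpace Ω] {X : ℝ≥0 → Ω → E} (hX : ∀ t, Measurable (X t))
    (hc : ∀ ω t, ContinuousWithinAt (fun s => X s ω) (Ici t) t) :
    Measurable fun p : ℝ≥0 × Ω => X p.1 p.2 := by
  have hcomp (c : ℕ → ℝ≥0) {N : ℝ≥0 → ℕ} (hN : Measurable N) :
      Measurable fun p : ℝ≥0 × Ω => X (c (N p.1)) p.2 :=
    (measurable_from_prod_countable_right (f := fun q : ℕ × Ω => X (c q.1) q.2)
      fun k => hX (c k)).comp ((hN.comp measurable_fst).prodMk measurable_snd)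
  -- The time is rounded to the first point of the grid of mesh `1/(n+1)` strictly after it, so the
  -- approximation is from the right.
  have hd (n : ℕ) : Measurable fun p : ℝ≥0 × Ω =>
      X (((⌊((n : ℝ≥0) + 1) * p.1⌋₊ : ℝ≥0) + 1) / (n + 1)) p.2 :=
    hcomp (fun k => ((k : ℝ≥0) + 1) / (n + 1)) (N := fun t => ⌊((n : ℝ≥0) + 1) * t⌋₊)
      (Nat.measurable_floor.comp (measurable_id.const_mul _))
  refine measurable_of_tendsto_metrizable hd (tendsto_pi_nhds.2 fun ⟨t, ω⟩ => ?_)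
  refine (hc ω t).tendsto.comp (tendsto_nhdsWithin_iff.2 ⟨?_, .of_forall fun n => ?_⟩)
  · refine tendsto_of_tendsto_of_tendsto_of_le_of_le (g := fun _ => t)
      (h := fun n : ℕ => t + 1 / ((n : ℝ≥0) + 1)) tendsto_const_nhds ?_ (fun n => ?_) fun n => ?_
    · simpa using tendsto_const_nhds.add (tendsto_one_div_add_atTop_nhds_zero_nat (𝕜 := ℝ≥0))
    · rw [le_div_iff₀ (by positivity), mul_comm]
      exact (Nat.lt_floor_add_one _).le
    · change _ / _ ≤ _
      rw [add_div]
      refine add_le_add_left ?_ _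
      rw [div_le_iff₀ (by positivity), mul_comm]
      exact Nat.floor_le zero_le
  · change t ≤ _ / _
    rw [le_div_iff₀ (by positivity), mul_comm]
    exact (Nat.lt_floor_add_one _).le

/-! ### The Markov property and the transition function -/

namespace BorelRightProcess

variable {E Ω : Type*} [TopologicalSpace E] [MeasurableSpace E] [mΩ : MeasurableSpace Ω]

theorem transition_apply (Z : BorelRightProcess E Ω) (t : ℝ≥0) (x : E) {B : Set E}
    (hB : MeasurableSet B) : Z.transition t x B = Z.P x (Z.X t ⁻¹' B) :=
  Measure.map_apply (Z.measurable_X t) hB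

theorem isProbabilityMeasure_transition (Z : BorelRightProcess E Ω) (t : ℝ≥0) (x : E) :
    IsProbabilityMeasure (Z.transition t x) :=
  have := Z.isProb x
  Measure.isProbabilityMeasure_map (Z.measurable_X t).aemeasurable

theorem measurable_transition_measure (Z : BorelRightProcess E Ω) (t : ℝ≥0) :
    Measurable (Z.transition t) := by
  refine Measure.measurable_of_measurable_coe _ fun B hB => ?_
  simp_rw [Z.transition_apply t _ hB]
  exact Z.measurable_transition t B hB

theorem measurable_lintegral_transition (Z : BorelRightProcess E Ω) (t : ℝ≥0) {f : E → ℝ≥0∞}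
    (hf : Measurable f) : Measurable fun x => ∫⁻ y, f y ∂Z.transition t x :=
  (Measure.measurable_lintegral hf).comp (Z.measurable_transition_measure t)

theorem lintegral_transition (Z : BorelRightProcess E Ω) (t : ℝ≥0) (x : E) {f : E → ℝ≥0∞}
    (hf : Measurable f) : ∫⁻ y, f y ∂Z.transition t x = ∫⁻ ω, f (Z.X t ω) ∂Z.P x :=
  lintegral_map hf (Z.measurable_X t)

theorem measurable_transition_time [TopologicalSpace.PseudoMetrizableSpace E] [BorelSpace E]
    (Z : BorelRightProcess E Ω) (x : E) : Measurable fun t => Z.transition t x := by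
  have := Z.isProb x
  refine Measure.measurable_of_measurable_coe _ fun B hB => ?_
  simp_rw [Z.transition_apply _ x hB]
  exact measurable_measure_prodMk_left
    (measurable_uncurry_of_rightContinuous Z.measurable_X Z.rightContinuous hB)

theorem measurable_X_minFiltration (Z : BorelRightProcess E Ω) {s t : ℝ≥0} (hst : s ≤ t) :
    Measurable[minFiltration Z.X Z.measurable_X t] (Z.X s) :=
  measurable_iff_comap_le.2 (le_iSup₂_of_le (f := fun s (_ : s ≤ t) =>
    MeasurableSpace.comap (Z.X s) inferInstance) s hst le_rfl)

/-- The Markov property at a fixed time, for events. -/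
theorem measure_inter_preimage_add (Z : BorelRightProcess E Ω) (t s : ℝ≥0) (x : E) {A : Set Ω}
    (hA : MeasurableSet[minFiltration Z.X Z.measurable_X t] A) {B : Set E}
    (hB : MeasurableSet B) :
    Z.P x (A ∩ Z.X (t + s) ⁻¹' B) = ∫⁻ ω in A, Z.transition s (Z.X t ω) B ∂Z.P x := by
  have hσ := isStoppingTime_const (minFiltration Z.X Z.measurable_X).rightCont t
  have hA' : MeasurableSet[hσ.measurableSpace] A := by
    rw [IsStoppingTime.measurableSpace_const]
    exact Filtration.le_rightCont _ t A hA
  have := Z.strongMarkov _ hσ A hA' x s B hB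
  simp_rw [Z.transition_apply _ _ hB]
  simp only [ne_eq, WithTop.coe_ne_top, not_false_eq_true, true_and, and_true,
    WithTop.untopD_coe, ofPred_mem_eq] at this
  exact this

/-- The Markov property at a fixed time, for functions of the future position. -/
theorem setLIntegral_comp_add (Z : BorelRightProcess E Ω) (t s : ℝ≥0) (x : E) {A : Set Ω}
    (hA : MeasurableSet[minFiltration Z.X Z.measurable_X t] A) {f : E → ℝ≥0∞}
    (hf : Measurable f) :
    ∫⁻ ω in A, f (Z.X (t + s) ω) ∂Z.P x =
      ∫⁻ ω in A, ∫⁻ y, f y ∂Z.transition s (Z.X t ω) ∂Z.P x := by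
  have hm := Z.measurable_transition_measure s
  have hA' : MeasurableSet A := (minFiltration Z.X Z.measurable_X).le t A hA
  have hmeas : ((Z.P x).restrict A).map (Z.X (t + s)) =
      (((Z.P x).restrict A).map (Z.X t)).bind (Z.transition s) := by
    ext B hB
    rw [Measure.map_apply (Z.measurable_X _) hB, Measure.bind_apply hB hm.aemeasurable,
      Measure.restrict_apply (Z.measurable_X _ hB), inter_comm,
      Z.measure_inter_preimage_add t s x hA hB,
      lintegral_map (f := fun y => Z.transition s y B) ((Measure.measurable_coe hB).comp hm)
        (Z.measurable_X t)]
  rw [← lintegral_map hf (Z.measurable_X _), hmeas,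
    Measure.lintegral_bind hm.aemeasurable hf.aemeasurable,
    lintegral_map (Z.measurable_lintegral_transition s hf) (Z.measurable_X t)]

/-- The Markov property at a fixed time. -/
theorem lintegral_mul_comp_add (Z : BorelRightProcess E Ω) (t s : ℝ≥0) (x : E) {F : Ω → ℝ≥0∞}
    (hF : Measurable[minFiltration Z.X Z.measurable_X t] F) {f : E → ℝ≥0∞} (hf : Measurable f) :
    ∫⁻ ω, F ω * f (Z.X (t + s) ω) ∂Z.P x =
      ∫⁻ ω, F ω * ∫⁻ y, f y ∂Z.transition s (Z.X t ω) ∂Z.P x := by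
  have hle := (minFiltration Z.X Z.measurable_X).le t
  have hF' : Measurable F := hF.mono hle le_rfl
  have h1 : Measurable fun ω => f (Z.X (t + s) ω) := hf.comp (Z.measurable_X _)
  have h2 : Measurable fun ω => ∫⁻ y, f y ∂Z.transition s (Z.X t ω) :=
    (Z.measurable_lintegral_transition s hf).comp (Z.measurable_X t)
  -- The two densities define the same measure on `ℱ⁰_t`, so the integrals of the `ℱ⁰_t`-measurable
  -- `F` agree.
  have htrim : ((Z.P x).withDensity fun ω => f (Z.X (t + s) ω)).trim hle =
      ((Z.P x).withDensity fun ω => ∫⁻ y, f y ∂Z.transition s (Z.X t ω)).trim hle := by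
    refine @Measure.ext _ (_) _ _ fun A hA => ?_
    rw [trim_measurableSet_eq hle hA, trim_measurableSet_eq hle hA,
      withDensity_apply _ (hle A hA), withDensity_apply _ (hle A hA),
      Z.setLIntegral_comp_add t s x hA hf]
  have h3 := lintegral_trim hle hF (μ := (Z.P x).withDensity fun ω => f (Z.X (t + s) ω))
  rw [htrim, lintegral_trim hle hF, lintegral_withDensity_eq_lintegral_mul _ h2 hF',
    lintegral_withDensity_eq_lintegral_mul _ h1 hF'] at h3
  simpa only [Pi.mul_apply, mul_comm] using h3.symm

theorem isMarkovTransition [TopologicalSpace.PseudoMetrizableSpace E] [BorelSpace E]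
    (Z : BorelRightProcess E Ω) : IsMarkovTransition Z.transition where
  isProb := Z.isProbabilityMeasure_transition
  measurable_space := Z.measurable_transition_measure
  measurable_time := Z.measurable_transition_time
  chapmanKolmogorov s t x f hf := by
    have := Z.setLIntegral_comp_add s t x MeasurableSet.univ hf
    simp only [Measure.restrict_univ] at this
    rw [Z.lintegral_transition _ x hf, this,
      Z.lintegral_transition _ x (Z.measurable_lintegral_transition t hf)]

/-! ### Finite-dimensional distributions and path laws -/

/-- Integrating out the last time point of a finite-dimensional distribution. -/
theorem lintegral_prod_insert (Z : BorelRightProcess E Ω) (x : E) {J : Finset ℝ≥0} {m : ℝ≥0}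
    (hm : m ∈ J) (hle : ∀ t ∈ J, t ≤ m) {u : ℝ≥0} (hu : m + u ∉ J) {f : ℝ≥0 → E → ℝ≥0∞}
    (hf : ∀ t, Measurable (f t)) :
    ∫⁻ ω, ∏ t ∈ insert (m + u) J, f t (Z.X t ω) ∂Z.P x =
      ∫⁻ ω, ∏ t ∈ J, Function.update f m
        (fun y => f m y * ∫⁻ z, f (m + u) z ∂Z.transition u y) t (Z.X t ω) ∂Z.P x := by
  have hprod : Measurable[minFiltration Z.X Z.measurable_X m]
      fun ω => ∏ t ∈ J, f t (Z.X t ω) :=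
    Finset.measurable_prod _ fun t ht => (hf t).comp (Z.measurable_X_minFiltration (hle t ht))
  calc ∫⁻ ω, ∏ t ∈ insert (m + u) J, f t (Z.X t ω) ∂Z.P x
      = ∫⁻ ω, (∏ t ∈ J, f t (Z.X t ω)) * f (m + u) (Z.X (m + u) ω) ∂Z.P x := by
        simp_rw [Finset.prod_insert hu, mul_comm]
    _ = ∫⁻ ω, (∏ t ∈ J, f t (Z.X t ω)) *
          ∫⁻ z, f (m + u) z ∂Z.transition u (Z.X m ω) ∂Z.P x :=
        Z.lintegral_mul_comp_add m u x hprod (hf _)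
    _ = _ := by
        refine lintegral_congr fun ω => ?_
        rw [← Finset.mul_prod_erase J _ hm, ← Finset.mul_prod_erase J _ hm, mul_right_comm]
        congr 1
        · simp
        · refine Finset.prod_congr rfl fun t ht => ?_
          simp [Finset.ne_of_mem_erase ht]

/-- The transition function determines the finite-dimensional distributions. -/
theorem lintegral_prod_eq_of_transition_eq {Ω' : Type*} [MeasurableSpace Ω']
    (Z : BorelRightProcess E Ω) (Z' : BorelRightProcess E Ω')
    (h : ∀ t x, Z'.transition t x = Z.transition t x) (x : E) (J : Finset ℝ≥0) :
    ∀ f : ℝ≥0 → E → ℝ≥0∞, (∀ t, Measurable (f t)) →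
      ∫⁻ ω, ∏ t ∈ J, f t (Z'.X t ω) ∂Z'.P x = ∫⁻ ω, ∏ t ∈ J, f t (Z.X t ω) ∂Z.P x := by
  have := Z.isProb x
  have := Z'.isProb x
  refine Finset.induction_on_max J (by simp) fun a s hs ih f hf => ?_
  have ha : a ∉ s := fun ha => lt_irrefl a (hs a ha)
  rcases s.eq_empty_or_nonempty with rfl | hne
  · simp only [insert_empty_eq, Finset.prod_singleton]
    rw [← Z.lintegral_transition a x (hf a), ← Z'.lintegral_transition a x (hf a), h]
  -- The new time `a` lies beyond all others, so the Markov property at the previous maximum absorbs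
  -- its factor into the one there.
  have hms := s.max'_mem hne
  obtain ⟨u, rfl⟩ : ∃ u, a = s.max' hne + u := exists_add_of_le (hs _ hms).le
  rw [Z'.lintegral_prod_insert x hms s.le_max' ha hf,
    Z.lintegral_prod_insert x hms s.le_max' ha hf]
  simp_rw [h]
  refine ih _ fun t => ?_
  rcases eq_or_ne t (s.max' hne) with rfl | ht
  · rw [Function.update_self]
    exact (hf _).mul (Z.measurable_lintegral_transition u (hf _))
  · rw [Function.update_of_ne ht]
    exact hf t

theorem measurable_path (Z : BorelRightProcess E Ω) : Measurable fun ω t => Z.X t ω :=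
  measurable_pi_lambda _ Z.measurable_X

theorem isProbabilityMeasure_pathLaw (Z : BorelRightProcess E Ω) (x : E) :
    IsProbabilityMeasure (Z.pathLaw x) :=
  have := Z.isProb x
  Measure.isProbabilityMeasure_map Z.measurable_path.aemeasurable

theorem pathLaw_pi (Z : BorelRightProcess E Ω) (x : E) (J : Finset ℝ≥0) {B : ℝ≥0 → Set E}
    (hB : ∀ t, MeasurableSet (B t)) :
    Z.pathLaw x ((J : Set ℝ≥0).pi B) =
      ∫⁻ ω, ∏ t ∈ J, (B t).indicator 1 (Z.X t ω) ∂Z.P x := by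
  have hC : MeasurableSet ((J : Set ℝ≥0).pi B) :=
    MeasurableSet.pi J.countable_toSet fun t _ => hB t
  rw [pathLaw, Measure.map_apply Z.measurable_path hC,
    ← lintegral_indicator_one (Z.measurable_path hC)]
  refine lintegral_congr fun ω => ?_
  by_cases hω : ∀ t ∈ J, Z.X t ω ∈ B t
  · rw [indicator_of_mem (by simpa using hω), Finset.prod_eq_one]
    · rfl
    · intro t ht
      rw [indicator_of_mem (hω t ht), Pi.one_apply]
  · rw [indicator_of_notMem (by simpa using hω)]
    push Not at hω
    obtain ⟨t, ht, htB⟩ := hω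
    exact (Finset.prod_eq_zero ht (indicator_of_notMem htB _)).symm

/-- The transition function determines the laws of paths. -/
theorem pathLaw_eq_of_transition_eq {Ω' : Type*} [MeasurableSpace Ω']
    (Z : BorelRightProcess E Ω) (Z' : BorelRightProcess E Ω')
    (h : ∀ t x, Z'.transition t x = Z.transition t x) (x : E) :
    Z'.pathLaw x = Z.pathLaw x := by
  have := Z.isProbabilityMeasure_pathLaw x
  have := Z'.isProbabilityMeasure_pathLaw x
  refine ext_of_generate_finite _ generateFrom_squareCylinders.symm
    (isPiSystem_squareCylinders (fun _ => MeasurableSpace.isPiSystem_measurableSet)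
      fun _ => MeasurableSet.univ) ?_ (by simp)
  rintro _ ⟨J, B, hB, rfl⟩
  have hB' : ∀ t, MeasurableSet (B t) := fun t => by simpa using hB t (mem_univ t)
  rw [Z.pathLaw_pi x J hB', Z'.pathLaw_pi x J hB']
  exact lintegral_prod_eq_of_transition_eq Z Z' h x J (fun t => (B t).indicator 1)
    fun t => measurable_one.indicator (hB' t)

end BorelRightProcess

/-! ### Eigenpairs and eigen-measures -/

section EigenTransition

variable {E : Type*} [MeasurableSpace E]

/-- Proportional functions define the same eigen-transition measures. -/
theorem eigenTransition_congr_of_eq_mul {AD : ℝ≥0 → E → Measure E} {π π' : E → ℝ} {c : ℝ}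
    (hc : 0 < c) (h : ∀ x, π' x = c * π x) (lam : ℝ) :
    eigenTransition AD π' lam = eigenTransition AD π lam := by
  funext t x
  simp only [eigenTransition, h, mul_div_mul_left _ _ hc.ne']

end EigenTransition

namespace BorelRightProcess

variable {E Ω : Type*} [TopologicalSpace E] [MeasurableSpace E] [mΩ : MeasurableSpace Ω]

section Uniqueness

theorem minFiltration_le_iSup_comap (Z : BorelRightProcess E Ω) (t : ℝ≥0) :
    minFiltration Z.X Z.measurable_X t ≤
      ⨆ t, MeasurableSpace.comap (Z.X t) inferInstance :=
  iSup₂_le fun s _ => le_iSup (fun t => MeasurableSpace.comap (Z.X t) inferInstance) s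

/-- A finite measure on `σ(X_t, t ≥ 0)` is determined by its restrictions to the `ℱ⁰_t`. -/
theorem measure_eq_of_forall_minFiltration (Z : BorelRightProcess E Ω) {μ ν : Measure Ω}
    [IsFiniteMeasure μ]
    (h : ∀ t (A : Set Ω), MeasurableSet[minFiltration Z.X Z.measurable_X t] A → μ A = ν A)
    {A : Set Ω}
    (hA : MeasurableSet[⨆ t, MeasurableSpace.comap (Z.X t) inferInstance] A) : μ A = ν A := by
  refine ext_on_measurableSpace_of_generate_finite mΩ
    {A | ∃ t, MeasurableSet[minFiltration Z.X Z.measurable_X t] A}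
    (fun A ⟨t, ht⟩ => h t A ht) (iSup_le fun t => (Z.measurable_X t).comap_le)
    (le_antisymm (iSup_le fun t B hB => ?_) ?_) ?_ (h 0 univ MeasurableSet.univ) hA
  · refine MeasurableSpace.measurableSet_generateFrom ⟨t, ?_⟩
    exact (Z.measurable_X_minFiltration le_rfl).comap_le B hB
  · exact MeasurableSpace.generateFrom_le fun B ⟨t, hB⟩ => Z.minFiltration_le_iSup_comap t B hB
  · rintro B ⟨s, hB⟩ C ⟨t, hC⟩ -
    exact ⟨max s t, ((minFiltration Z.X Z.measurable_X).mono (le_max_left s t) B hB).inter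
      ((minFiltration Z.X Z.measurable_X).mono (le_max_right s t) C hC)⟩

end Uniqueness

section TransitionIndependent

variable {Z : BorelRightProcess E Ω} {S : ℝ≥0 → Ω → ℝ} {π : E → ℝ} {lam : ℝ}

theorem TransitionIndependent.ae_eq (hS : Z.TransitionIndependent S π lam) (x : E) :
    ∀ᵐ ω ∂Z.P x, ∀ t : ℝ≥0, S t ω = Real.exp (-(lam * t)) * (π x / π (Z.X t ω)) := by
  filter_upwards [hS.kernel_eq x, Z.normal x] with ω h h0 t
  rw [h t, h0]

theorem TransitionIndependent.statePrice_eq (hS : Z.TransitionIndependent S π lam) (t : ℝ≥0)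
    (x : E) : Z.statePrice S t x = (Z.transition t x).withDensity
      fun y => ENNReal.ofReal (Real.exp (-(lam * t)) * (π x / π y)) := by
  have hm := hS.measurable
  ext B hB
  rw [statePrice, Measure.map_apply (Z.measurable_X t) hB,
    withDensity_apply _ (Z.measurable_X t hB), withDensity_apply _ hB, transition,
    setLIntegral_map hB (by fun_prop) (Z.measurable_X t)]
  refine setLIntegral_congr_fun_ae (Z.measurable_X t hB) ?_
  filter_upwards [hS.ae_eq x] with ω hω _
  rw [hω t]

/-- The two densities multiply, so `Q^{π'}` becomes the transform of `P` by `π'/π`, with rate `lam'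
- lam`. -/
theorem TransitionIndependent.eigenTransition_statePrice
    (hS : Z.TransitionIndependent S π lam) {π' : E → ℝ} (hm' : Measurable π')
    (hpos' : ∀ x, 0 < π' x) (lam' : ℝ) (t : ℝ≥0) (x : E) :
    eigenTransition (Z.statePrice S) π' lam' t x = (Z.transition t x).withDensity fun y =>
      ENNReal.ofReal (Real.exp ((lam' - lam) * t) * (π' y / π y / (π' x / π x))) := by
  have hm := hS.measurable
  rw [eigenTransition, hS.statePrice_eq, ← withDensity_mul _ (by fun_prop) (by fun_prop)]
  congr 1
  funext y
  have h1 := hS.pos x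
  have h2 := hS.pos y
  have h3 := hpos' x
  have h4 := hpos' y
  rw [Pi.mul_apply, ← ENNReal.ofReal_mul (by positivity), sub_mul, sub_eq_neg_add, Real.exp_add]
  congr 1
  field_simp

theorem TransitionIndependent.eigenTransition_eq_transition
    (hS : Z.TransitionIndependent S π lam) :
    eigenTransition (Z.statePrice S) π lam = Z.transition := by
  funext t x
  rw [hS.eigenTransition_statePrice hS.measurable hS.pos]
  have h : ∀ y, π y / π y = 1 := fun y => div_self (hS.pos y).ne'
  simp only [h, sub_self, zero_mul, Real.exp_zero, div_one, mul_one, ENNReal.ofReal_one]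
  exact withDensity_one

theorem TransitionIndependent.lintegral_statePrice (hS : Z.TransitionIndependent S π lam)
    {f : E → ℝ} (hf : Measurable f) (t : ℝ≥0) (x : E) :
    ∫⁻ y, ENNReal.ofReal (f y) ∂Z.statePrice S t x =
      ENNReal.ofReal (Real.exp (-(lam * t)) * π x) *
        ∫⁻ y, ENNReal.ofReal (f y / π y) ∂Z.transition t x := by
  have hm := hS.measurable
  have hx := hS.pos x
  rw [hS.statePrice_eq, lintegral_withDensity_eq_lintegral_mul _ (by fun_prop) (by fun_prop),
    ← lintegral_const_mul _ (by fun_prop)]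
  refine lintegral_congr fun y => ?_
  have hy := hS.pos y
  rw [Pi.mul_apply, ← ENNReal.ofReal_mul (by positivity), ← ENNReal.ofReal_mul (by positivity)]
  congr 1
  ring

theorem TransitionIndependent.isPositiveEigenpair (hS : Z.TransitionIndependent S π lam) :
    IsPositiveEigenpair (Z.statePrice S) π lam where
  measurable := hS.measurable
  pos := hS.pos
  eigen t x := by
    have := Z.isProbabilityMeasure_transition t x
    rw [hS.lintegral_statePrice hS.measurable]
    simp [div_self (hS.pos _).ne']

theorem TransitionIndependent.isRecurrentEigenpair (hS : Z.TransitionIndependent S π lam)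
    (hZ : Z.IsRecurrent) : IsRecurrentEigenpair (Z.statePrice S) π lam :=
  ⟨hS.isPositiveEigenpair, by rw [hS.eigenTransition_eq_transition]; exact hZ⟩

/-- The density defining the eigen-measure of `(c π, λ)` is almost surely one. -/
theorem TransitionIndependent.lintegral_density_eq (hS : Z.TransitionIndependent S π lam)
    {π' : E → ℝ} {c : ℝ} (hc : 0 < c) (h : ∀ x, π' x = c * π x) (t : ℝ≥0) (x : E) (A : Set Ω) :
    ∫⁻ ω in A, ENNReal.ofReal
      (Real.exp (lam * t) * (π' (Z.X t ω) / π' (Z.X 0 ω)) * S t ω) ∂Z.P x = Z.P x A := by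
  rw [← setLIntegral_one]
  refine lintegral_congr_ae (ae_restrict_of_ae ?_)
  filter_upwards [hS.kernel_eq x] with ω hω
  have h1 := hS.pos (Z.X t ω)
  have h2 := hS.pos (Z.X 0 ω)
  rw [hω t, h, h, Real.exp_neg, ← ENNReal.ofReal_one]
  congr 1
  field_simp

theorem TransitionIndependent.isEigenMeasure (hS : Z.TransitionIndependent S π lam) :
    Z.IsEigenMeasure S π lam Z.P := fun t x A _ =>
  (hS.lintegral_density_eq one_pos (fun _ => (one_mul _).symm) t x A).symm

/-- Uniqueness of the recurrent eigenpair. -/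
theorem TransitionIndependent.eq_of_isRecurrentEigenpair
    [TopologicalSpace.PseudoMetrizableSpace E] [BorelSpace E] [Nonempty E]
    (hS : Z.TransitionIndependent S π lam) (hZ : Z.IsRecurrent) {π' : E → ℝ} {lam' : ℝ}
    (h : IsRecurrentEigenpair (Z.statePrice S) π' lam') :
    lam' = lam ∧ ∃ c : ℝ, 0 < c ∧ ∀ x, π' x = c * π x := by
  obtain ⟨⟨hm', hpos', heig⟩, hrec⟩ := h
  have hm := hS.measurable
  have hQ : eigenTransition (Z.statePrice S) π' lam' = fun t x =>
      (Z.transition t x).withDensity fun y =>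
        ENNReal.ofReal (Real.exp ((lam' - lam) * t) * (π' y / π y / (π' x / π x))) := by
    funext t x
    exact hS.eigenTransition_statePrice hm' hpos' lam' t x
  rw [hQ] at hrec
  -- The eigen-equation for `π'`, divided by the positive finite factor `e^{-λt} π(x)`.
  have heig' : ∀ (t : ℝ≥0) x, ∫⁻ y, ENNReal.ofReal (π' y / π y) ∂Z.transition t x =
      ENNReal.ofReal (Real.exp (-((lam' - lam) * t)) * (π' x / π x)) := by
    intro t x
    have hx := hS.pos x
    have hpos : 0 < Real.exp (-(lam * t)) * π x := by positivity
    have := heig t x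
    rw [hS.lintegral_statePrice hm'] at this
    refine (ENNReal.mul_right_inj (ENNReal.ofReal_pos.2 hpos).ne' ENNReal.ofReal_ne_top).1
      (this.trans ?_)
    rw [← ENNReal.ofReal_mul hpos.le]
    congr 1
    have hexp : Real.exp (-(lam' * t)) =
        Real.exp (-(lam * t)) * Real.exp (-((lam' - lam) * t)) := by
      rw [← Real.exp_add]
      congr 1
      ring
    rw [hexp]
    field_simp
  obtain ⟨h0, c, hc, hπ⟩ := Z.isMarkovTransition.eq_zero_and_exists_eq_of_recurrent_transform hZ
    (h := fun y => π' y / π y) (hm'.div hm) (fun y => div_pos (hpos' y) (hS.pos y)) heig' hrec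
  exact ⟨sub_eq_zero.1 h0, c, hc, fun x => (div_eq_iff (hS.pos x).ne').1 (hπ x)⟩

end TransitionIndependent

end BorelRightProcess


/-! ### The recovery theorem -/

theorem theorem3p3 {E : Type*} [TopologicalSpace E] [MeasurableSpace E] [BorelSpace E]
    [LusinSpace E] [Nonempty E] {Ω : Type*} [MeasurableSpace Ω]
    -- the true model: a recurrent process and a transition independent pricing kernel
    (Z : BorelRightProcess E Ω) (hZ : Z.IsRecurrent)
    (S : ℝ≥0 → Ω → ℝ) (π : E → ℝ) (lam : ℝ) (hS : Z.TransitionIndependent S π lam)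
    -- the observed state prices
    (AD : ℝ≥0 → E → Measure E) (hAD : Z.statePrice S = AD) :
    -- `(π, λ)` is a recurrent eigenpair of the state prices, and the physical measure is its
    -- eigen-measure
    IsRecurrentEigenpair AD π lam ∧
    Z.IsEigenMeasure S π lam Z.P ∧
    (∀ t x, Z.transition t x = eigenTransition AD π lam t x) ∧
    -- the recurrent eigenpair and the recurrent eigen-measure are unique
    (∀ (π' : E → ℝ) (lam' : ℝ), IsRecurrentEigenpair AD π' lam' →
      lam' = lam ∧ (∃ c : ℝ, 0 < c ∧ ∀ x, π' x = c * π x) ∧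
      (∀ t x, eigenTransition AD π' lam' t x = Z.transition t x) ∧
      ∀ Q : E → Measure Ω, Z.IsEigenMeasure S π' lam' Q →
        ∀ x (A : Set Ω), MeasurableSet[⨆ t, MeasurableSpace.comap (Z.X t) inferInstance] A →
          Q x A = Z.P x A) ∧
    -- any model of this kind with the same state prices has the same physical probabilities
    -- and the same pricing kernel
    (∀ (Ω' : Type*) [MeasurableSpace Ω'] (Z' : BorelRightProcess E Ω'), Z'.IsRecurrent →
      ∀ (S' : ℝ≥0 → Ω' → ℝ) (π' : E → ℝ) (lam' : ℝ), Z'.TransitionIndependent S' π' lam' →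
        Z'.statePrice S' = AD →
          (∀ t x, Z'.transition t x = Z.transition t x) ∧
          (∀ x, Z'.pathLaw x = Z.pathLaw x) ∧
          lam' = lam ∧ (∃ c : ℝ, 0 < c ∧ ∀ x, π' x = c * π x) ∧
          (∀ x, ∀ᵐ ω ∂Z'.P x, ∀ t : ℝ≥0,
            S' t ω = Real.exp (-(lam * t)) * (π (Z'.X 0 ω) / π (Z'.X t ω)))) := by

  subst hAD
  have := LusinSpace.metrizableSpace E
  have hPQ := hS.eigenTransition_eq_transition
  refine ⟨hS.isRecurrentEigenpair hZ, hS.isEigenMeasure, fun t x => by rw [hPQ], ?_, ?_⟩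
  · intro π' lam' hπ'
    obtain ⟨rfl, c, hc, hcπ⟩ := hS.eq_of_isRecurrentEigenpair hZ hπ'
    refine ⟨rfl, ⟨c, hc, hcπ⟩, fun t x => ?_, fun Q hQ x A hA => ?_⟩
    · rw [eigenTransition_congr_of_eq_mul hc hcπ, hPQ]
    · have := Z.isProb x
      -- Reversed because the lemma needs finiteness of its first measure, known directly for `Z.P
      -- x`.
      refine (Z.measure_eq_of_forall_minFiltration (fun t B hB => ?_) hA).symm
      rw [hQ t x B hB, hS.lintegral_density_eq hc hcπ]
  · intro Ω' _ Z' hZ' S' π' lam' hS' hAD'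
    have hrec := hS'.isRecurrentEigenpair hZ'
    have hPQ' := hS'.eigenTransition_eq_transition
    rw [hAD'] at hrec hPQ'
    -- The second model's pair is a recurrent eigenpair of the same state prices, so uniqueness in
    -- the first model identifies it.
    obtain ⟨rfl, c, hc, hcπ⟩ := hS.eq_of_isRecurrentEigenpair hZ hrec
    have htr : ∀ t x, Z'.transition t x = Z.transition t x := fun t x => by
      rw [← hPQ', eigenTransition_congr_of_eq_mul hc hcπ, hPQ]
    refine ⟨htr, Z.pathLaw_eq_of_transition_eq Z' htr, rfl, ⟨c, hc, hcπ⟩, fun x => ?_⟩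
    filter_upwards [hS'.kernel_eq x] with ω hω t
    rw [hω t, hcπ, hcπ, mul_div_mul_left _ _ hc.ne']
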